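/- Let $\varphi_0,\varphi_1,\dots$ be an acceptable enumeration of the partial computable functions on $\mathbb N$, and let $W_d$ be the domain of $\varphi_d$. Say that $i=\langle c,d\rangle\in\mathbb N$ is an index of a recursive presentation if $\varphi_c$ is total and is the characteristic function of a set $X\subseteq\mathbb N$ and every element of $W_d$ is the code of a group word over $X$ (a finite string of elements of $X$ and their formal inverses); the group $G_i$ presented is then the one with generating set $X$ and with the words coded in $W_d$ as relators. A group is left-orderable if it admits a total order $\preceq$ with $g\preceq h\Rightarrow ag\preceq ah$ for all $a,g,h$, and bi-orderable if it admits a total order which is invariant under both left and right multiplication. Let $A$ be the set of all indices $i$ of recursive presentations for which $G_i$ is left-orderable, and let $B$ be the set of all $i\in A$ for which $G_i$ is bi-orderable. **Theorem.** Identification of bi-orderability is $\Pi^0_2$-complete in the class of recursively presented left-orderable groups. That is: 1. there is a $\Pi^0_2$ set $\Phi\subseteq\mathbb N$ with $B=A\cap\Phi$; and 2. for every $\Pi^0_2$ set $S\subseteq\mathbb N$ there is a computable function $f:\mathbb N\to\mathbb N$ with $f(e)\in A$ for all $e\in\mathbb N$, such that $e\in S$ if and only if $f(e)\in B$. Here a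 set $S\subseteq\mathbb N$ is $\Pi^0_2$ if there is a computable relation $R\subseteq\mathbb N^3$ such that $e\in S\iff\forall x\,\exists y\,R(e,x,y)$. -/

import Mathlib

/-- The `e`-th partial computable function on `ℕ`. -/
def phi (e : ℕ) : ℕ →. ℕ := (Denumerable.ofNat Nat.Partrec.Code e).eval

/-- The `e`-th computably enumerable set: the domain of `phi e`. -/
def ceSet (e : ℕ) : Set ℕ := {n | (phi e n).Dom}

/-- A set of natural numbers is `Π⁰₂` if it is defined by a formula `∀ x ∃ y R(e, x, y)` with a
computable matrix `R`. -/
def IsPi02 (S : Set ℕ) : Prop :=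
  ∃ R : ℕ × ℕ × ℕ → Prop, ComputablePred R ∧ ∀ e, e ∈ S ↔ ∀ x, ∃ y, R (e, x, y)

/-- The set of generators described by the number `i`, read as a pair `(c, d)`: the subset of `ℕ`
whose characteristic function is `phi c` (see `IsPresentationIndex`). -/
def generators (i : ℕ) : Set ℕ := {n | 1 ∈ phi i.unpair.1 n}

/-- The code of a (not necessarily reduced) group word over a set `X` of generators. A word is a
list of letters `(x, b)`, where `(x, true)` is the generator `x` and `(x, false)` its inverse. -/
def wordCode {X : Set ℕ} (w : List (X × Bool)) : ℕ :=
  Encodable.encode (w.map fun p => ((p.1 : ℕ), p.2))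

/-- `i = (c, d)` is an index of a recursive presentation: `phi c` is the characteristic function of
a set of generators, and the `d`-th c.e. set consists of codes of words over these generators. -/
def IsPresentationIndex (i : ℕ) : Prop :=
  (∀ n, phi i.unpair.1 n = Part.some 0 ∨ phi i.unpair.1 n = Part.some 1) ∧
  ∀ n ∈ ceSet i.unpair.2, ∃ w : List (generators i × Bool), wordCode w = n

/-- The set of relators of the presentation with index `i = (c, d)`: the elements of the free group
given by the words whose codes are in the `d`-th c.e. set. -/
def relators (i : ℕ) : Set (FreeGroup (generators i)) :=
  {r | ∃ w : List (generators i × Bool), wordCode w ∈ ceSet i.unpair.2 ∧ FreeGroup.mk w = r}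

/-- The group given by the presentation with index `i`. -/
abbrev groupOf (i : ℕ) : Type := PresentedGroup (relators i)

/-- A group is left-orderable if it has a total order invariant under left multiplication. -/
def LeftOrderable (G : Type*) [Group G] : Prop :=
  ∃ _ : LinearOrder G, ∀ a g h : G, g ≤ h → a * g ≤ a * h

/-- A group is bi-orderable if it has a total order invariant under left and right
multiplication. -/
def BiOrderable (G : Type*) [Group G] : Prop :=
  ∃ _ : LinearOrder G, (∀ a g h : G, g ≤ h → a * g ≤ a * h) ∧ (∀ a g h : G, g ≤ h → g * a ≤ h * a)

/-- The indices of recursive presentations of left-orderable groups. -/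
def leftOrderableIndices : Set ℕ := {i | IsPresentationIndex i ∧ LeftOrderable (groupOf i)}

/-- Let `A` be a set of indices, `P` a property of indices and `B` the set of `i ∈ A` with `P i`.
Detecting `P` is in `Γ` within `A` if `B` is the intersection of `A` with a set in `Γ`. -/
def DetectionIn (Γ : Set ℕ → Prop) (A : Set ℕ) (P : ℕ → Prop) : Prop :=
  ∃ S : Set ℕ, Γ S ∧ {i ∈ A | P i} = A ∩ S

/-- Detecting `P` is `Γ`-hard within `A` if each set in `Γ` is reducible to `{i ∈ A | P i}` by a
computable function with all its values in `A`. -/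
def DetectionHard (Γ : Set ℕ → Prop) (A : Set ℕ) (P : ℕ → Prop) : Prop :=
  ∀ S : Set ℕ, Γ S → ∃ f : ℕ → ℕ, Computable f ∧ (∀ e, f e ∈ A) ∧
    ∀ e, e ∈ S ↔ f e ∈ {i ∈ A | P i}

/-- Detecting `P` is `Γ`-complete within `A`. -/
def DetectionComplete (Γ : Set ℕ → Prop) (A : Set ℕ) (P : ℕ → Prop) : Prop :=
  DetectionIn Γ A P ∧ DetectionHard Γ A P

/-! Upper bound. A bi-order on a countable group is a positive cone, and a cone is a truth
assignment `P` on words satisfying a set of clauses, each involving finitely many words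
(`biOrderable_iff_coneClause`). By compactness (`exists_forall_coneClause`) it suffices that every
finite set of clauses is satisfiable. The clauses also mention the set `Z` of words representing the
identity, which is only c.e. and occurs with both signs. So the formula reads: for all finite lists
`L` of clauses and `T` of certificates there are a further list `T'` and a finite assignment
satisfying `L`, where `Z` means certified in `T ++ T'`. Certificates are sound, so either player can
make this approximation exact on `L`, and the formula is `Π⁰₂`.

Hardness. Let `S` be given by `∀ x, T e x` with `T e` c.e. In a product of Klein bottle groups, one
for each `x`, replace `b` by the identity in copy `x` once `T e x` holds, and take the subgroup
generated by all the letters. It is left-orderable in every case. If all `T e x` hold, it is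
abelian, hence bi-orderable. Otherwise some `b ≠ 1` is conjugate to its inverse, which no bi-order
allows. The relations of this group are c.e. uniformly in `e` (`rePred_kleinHom_eq_one`). -/

/-! ### Clauses for bi-orders and compactness -/

/-- A word in letters `n` and `n⁻¹` for `n : ℕ`. -/
abbrev Word : Type := List (ℕ × Bool)

/-- The clauses on the words `u` and `v` which say that the set `P` of words describes the positive
cone of a bi-order on a group in which `Z` is the set of words representing the identity. -/
def ConeClause (P Z : Word → Prop) (u v : Word) : Prop :=
  (P u → P v → P (u ++ v)) ∧ (P u → P (v ++ u ++ FreeGroup.invRev v)) ∧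
    (Z u → ¬ P u) ∧ (Z u ∨ P u ∨ P (FreeGroup.invRev u))

/-- A clause depends only on the values of `P` at finitely many words. -/
theorem coneClause_congr {P Q Z Y : Word → Prop} {u v : Word} (hu : P u ↔ Q u) (hv : P v ↔ Q v)
    (huv : P (u ++ v) ↔ Q (u ++ v))
    (hc : P (v ++ u ++ FreeGroup.invRev v) ↔ Q (v ++ u ++ FreeGroup.invRev v))
    (hi : P (FreeGroup.invRev u) ↔ Q (FreeGroup.invRev u)) (hZ : Z u ↔ Y u) :
    ConeClause P Z u v ↔ ConeClause Q Y u v := by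
  unfold ConeClause
  rw [hu, hv, huv, hc, hi, hZ]

/-- Compactness: if each finite set of clauses is satisfiable, then so is the set of all clauses. -/
theorem exists_forall_coneClause {Z : Word → Prop}
    (h : ∀ L : List (Word × Word), ∃ P : Word → Prop, ∀ q ∈ L, ConeClause P Z q.1 q.2) :
    ∃ P : Word → Prop, ∀ u v, ConeClause P Z u v := by
  have h' : ∀ F : Finset (Word × Word), ∃ P : Word → Prop, ∀ q ∈ F, ConeClause P Z q.1 q.2 := by
    intro F
    simpa using h F.toList
  choose P hP using h'
  -- `U` contains every set of all `F` above a given pair, so each clause holds for `U`-almost all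
  -- `F`; being a Boolean combination of values of `P`, it passes to the limit along `U`.
  let U : Ultrafilter (Finset (Word × Word)) := Ultrafilter.of Filter.atTop
  refine ⟨fun w => ∀ᶠ F in U, P F w, fun u v => ?_⟩
  have key : ∀ᶠ F in U, ConeClause (P F) Z u v := by
    have h1 : ∀ᶠ F in (Filter.atTop : Filter (Finset (Word × Word))), ConeClause (P F) Z u v := by
      filter_upwards [Filter.eventually_ge_atTop {(u, v)}] with F hF
      exact hP F (u, v) (hF (Finset.mem_singleton_self _))
    exact Ultrafilter.of_le _ h1
  refine ⟨fun hu hv => ?_, fun hu => ?_, fun hz hu => ?_, ?_⟩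
  · filter_upwards [key, hu, hv] with F hF using hF.1
  · filter_upwards [key, hu] with F hF using hF.2.1
  · obtain ⟨F, hF, hFu⟩ := (key.and hu).exists
    exact hF.2.2.1 hz hFu
  · by_cases hz : Z u
    · exact Or.inl hz
    · refine Or.inr (Ultrafilter.eventually_or.1 ?_)
      filter_upwards [key] with F hF using hF.2.2.2.resolve_left hz

/-! ### Positive cones and orders -/

section Cone

variable {H : Type*} [Group H]

/-- A positive cone defines a linear order. -/
theorem exists_linearOrder_of_cone (C : Set H) (hmul : ∀ g ∈ C, ∀ h ∈ C, g * h ∈ C)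
    (hone : (1 : H) ∉ C) (htot : ∀ g, g = 1 ∨ g ∈ C ∨ g⁻¹ ∈ C) :
    ∃ _ : LinearOrder H, ∀ g h : H, g ≤ h ↔ g = h ∨ g⁻¹ * h ∈ C := by
  refine ⟨{ le := fun g h => g = h ∨ g⁻¹ * h ∈ C
            le_refl := fun g => Or.inl rfl
            le_trans := ?_
            le_antisymm := ?_
            le_total := ?_
            toDecidableLE := Classical.decRel _ }, fun g h => Iff.rfl⟩
  · rintro g h k (rfl | h1) (rfl | h2)
    · exact Or.inl rfl
    · exact Or.inr h2
    · exact Or.inr h1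
    · exact Or.inr (by simpa [mul_assoc] using hmul _ h1 _ h2)
  · rintro g h (rfl | h1) (h2 | h2)
    · rfl
    · rfl
    · exact h2.symm
    · exact absurd (by simpa [mul_assoc] using hmul _ h1 _ h2) hone
  · intro g h
    rcases htot (g⁻¹ * h) with h1 | h1 | h1
    · exact Or.inl (Or.inl (inv_mul_eq_one.1 h1))
    · exact Or.inl (Or.inr h1)
    · exact Or.inr (Or.inr (by simpa using h1))

/-- A group with a positive cone is left-orderable. -/
theorem leftOrderable_of_cone (C : Set H) (hmul : ∀ g ∈ C, ∀ h ∈ C, g * h ∈ C)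
    (hone : (1 : H) ∉ C) (htot : ∀ g, g = 1 ∨ g ∈ C ∨ g⁻¹ ∈ C) : LeftOrderable H := by
  obtain ⟨o, ho⟩ := exists_linearOrder_of_cone C hmul hone htot
  refine ⟨o, fun a g h hgh => (ho _ _).2 ?_⟩
  rcases (ho _ _).1 hgh with rfl | h1
  · exact Or.inl rfl
  · exact Or.inr (by simpa [mul_assoc] using h1)

/-- A group with a conjugation invariant positive cone is bi-orderable. -/
theorem biOrderable_of_cone (C : Set H) (hmul : ∀ g ∈ C, ∀ h ∈ C, g * h ∈ C)
    (hconj : ∀ g ∈ C, ∀ h, h * g * h⁻¹ ∈ C) (hone : (1 : H) ∉ C)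
    (htot : ∀ g, g = 1 ∨ g ∈ C ∨ g⁻¹ ∈ C) : BiOrderable H := by
  obtain ⟨o, ho⟩ := exists_linearOrder_of_cone C hmul hone htot
  refine ⟨o, fun a g h hgh => (ho _ _).2 ?_, fun a g h hgh => (ho _ _).2 ?_⟩
  · rcases (ho _ _).1 hgh with rfl | h1
    · exact Or.inl rfl
    · exact Or.inr (by simpa [mul_assoc] using h1)
  · rcases (ho _ _).1 hgh with rfl | h1
    · exact Or.inl rfl
    · exact Or.inr (by simpa [mul_assoc] using hconj _ h1 a⁻¹)

/-- A group generated by a sequence of elements is bi-orderable if and only if the clauses over the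
set of words representing the identity are satisfiable. -/
theorem biOrderable_iff_coneClause (φ : FreeGroup ℕ →* H) (hφ : Function.Surjective φ) :
    BiOrderable H ↔
      ∃ P : Word → Prop, ∀ u v, ConeClause P (fun w => φ (FreeGroup.mk w) = 1) u v := by
  constructor
  · rintro ⟨_, hl, hr⟩
    have hlt : ∀ a g h : H, g < h → a * g < a * h := fun a g h hgh =>
      lt_of_le_of_ne (hl a g h hgh.le) fun he => hgh.ne (mul_left_cancel he)
    have hrt : ∀ a g h : H, g < h → g * a < h * a := fun a g h hgh =>
      lt_of_le_of_ne (hr a g h hgh.le) fun he => hgh.ne (mul_right_cancel he)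
    refine ⟨fun w => 1 < φ (FreeGroup.mk w), fun u v => ⟨fun hu hv => ?_, fun hu => ?_,
      fun hz hu => ?_, ?_⟩⟩
    · have h1 := hlt (φ (FreeGroup.mk u)) _ _ hv
      rw [mul_one, ← map_mul, FreeGroup.mul_mk] at h1
      exact hu.trans h1
    · have h1 := hrt (φ (FreeGroup.mk v))⁻¹ _ _ (hlt (φ (FreeGroup.mk v)) _ _ hu)
      rwa [mul_one, mul_inv_cancel, ← map_mul, ← map_inv, ← map_mul, FreeGroup.inv_mk,
        FreeGroup.mul_mk, FreeGroup.mul_mk] at h1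
    · exact hu.ne' hz
    · rcases lt_trichotomy (φ (FreeGroup.mk u)) 1 with h1 | h1 | h1
      · have h2 := hlt (φ (FreeGroup.mk u))⁻¹ _ _ h1
        rw [mul_one, inv_mul_cancel, ← map_inv, FreeGroup.inv_mk] at h2
        exact Or.inr (Or.inr h2)
      · exact Or.inl h1
      · exact Or.inr (Or.inl h1)
  · rintro ⟨P, hP⟩
    have hsurj : ∀ g : H, ∃ w : Word, φ (FreeGroup.mk w) = g := fun g => by
      obtain ⟨x, rfl⟩ := hφ g
      exact ⟨x.toWord, by rw [FreeGroup.mk_toWord]⟩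
    have hone : ∀ w, P w → φ (FreeGroup.mk w) ≠ 1 := fun w hw h1 => (hP w w).2.2.1 h1 hw
    have hcongr : ∀ u v, φ (FreeGroup.mk u) = φ (FreeGroup.mk v) → P u → P v := by
      intro u v huv hu
      rcases (hP v v).2.2.2 with h1 | h1 | h1
      · exact absurd (huv.trans h1) (hone u hu)
      · exact h1
      · refine absurd ?_ (hone _ ((hP u _).1 hu h1))
        rw [← FreeGroup.mul_mk, ← FreeGroup.inv_mk, map_mul, map_inv, huv, mul_inv_cancel]
    -- The cone is the image of `P` in `H`; the third clause keeps the identity out of it.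
    refine biOrderable_of_cone {g | ∃ w, P w ∧ φ (FreeGroup.mk w) = g} ?_ ?_ ?_ ?_
    · rintro _ ⟨u, hu, rfl⟩ _ ⟨v, hv, rfl⟩
      exact ⟨u ++ v, (hP u v).1 hu hv, by rw [← FreeGroup.mul_mk, map_mul]⟩
    · rintro _ ⟨u, hu, rfl⟩ h
      obtain ⟨v, rfl⟩ := hsurj h
      refine ⟨_, (hP u v).2.1 hu, ?_⟩
      rw [← FreeGroup.mul_mk, ← FreeGroup.mul_mk, ← FreeGroup.inv_mk, map_mul, map_mul, map_inv]
    · rintro ⟨w, hw, h1⟩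
      exact hone w hw h1
    · intro g
      obtain ⟨u, rfl⟩ := hsurj g
      rcases (hP u u).2.2.2 with h1 | h1 | h1
      · exact Or.inl h1
      · exact Or.inr (Or.inl ⟨u, h1, rfl⟩)
      · exact Or.inr (Or.inr ⟨_, h1, by rw [← FreeGroup.inv_mk, map_inv]⟩)

end Cone

/-! ### Primitive recursive operations on words -/

open Nat.Partrec (Code)

/-- A set defined by a primitive recursive matrix with quantifiers over arbitrary codable types is
`Π⁰₂`. -/
theorem isPi02_of_primrecPred {α β : Type*} [Primcodable α] [Primcodable β] {S : Set ℕ}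
    {R : ℕ × α × β → Prop} (hR : PrimrecPred R) (hS : ∀ e, e ∈ S ↔ ∀ a, ∃ b, R (e, a, b)) :
    IsPi02 S := by
  classical
  -- A number coding no element of `α` passes vacuously; one coding no element of `β` is not a
  -- witness.
  let m : ℕ × ℕ × ℕ → Bool := fun p =>
    Option.casesOn (Encodable.decode (α := α) p.2.1) true fun a =>
      Option.casesOn (Encodable.decode (α := β) p.2.2) false fun b => decide (R (p.1, a, b))
  have hm : Primrec m := by
    refine Primrec.option_casesOn (Primrec.decode.comp (Primrec.fst.comp Primrec.snd))
      (Primrec.const _) (Primrec₂.mk ?_)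
    refine Primrec.option_casesOn
      (Primrec.decode.comp (Primrec.snd.comp (Primrec.snd.comp Primrec.fst)))
      (Primrec.const _) (Primrec₂.mk ?_)
    exact hR.decide.comp (Primrec.pair (Primrec.fst.comp (Primrec.fst.comp Primrec.fst))
      (Primrec.pair (Primrec.snd.comp Primrec.fst) Primrec.snd))
  refine ⟨fun p => m p = true, (ComputablePred.computable_iff.2 ⟨m, hm.to_comp, rfl⟩), fun e => ?_⟩
  rw [hS]
  constructor
  · intro h x
    cases hx : Encodable.decode (α := α) x with
    | none => exact ⟨0, by simp [m, hx]⟩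
    | some a =>
      obtain ⟨b, hb⟩ := h a
      exact ⟨Encodable.encode b, by simpa [m, hx] using hb⟩
  · intro h a
    obtain ⟨y, hy⟩ := h (Encodable.encode a)
    cases hb : Encodable.decode (α := β) y with
    | none => simp [m, hb] at hy
    | some b => exact ⟨b, by simpa [m, hb] using hy⟩

section Primrec

variable {α : Type*} [Primcodable α]

theorem primrec_invRev : Primrec (FreeGroup.invRev : Word → Word) :=
  Primrec.list_reverse.comp (Primrec.list_map Primrec.id (Primrec.to₂
    (Primrec.pair (Primrec.fst.comp Primrec.snd)
      (Primrec.not.comp (Primrec.snd.comp Primrec.snd)))))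

theorem primrec_reduce : Primrec (FreeGroup.reduce : Word → Word) := by
  let step : ℕ × Bool → Word → Word := fun x l =>
    List.casesOn l [x] fun y t => if x.1 = y.1 ∧ x.2 = !y.2 then t else x :: y :: t
  have hs : Primrec₂ step := by
    refine Primrec₂.mk (Primrec.list_casesOn (h := fun (p q : (ℕ × Bool) × Word) =>
      if p.1.1 = q.1.1 ∧ p.1.2 = !q.1.2 then q.2 else p.1 :: q.1 :: q.2) Primrec.snd
      (Primrec.list_cons.comp Primrec.fst (Primrec.const [])) (Primrec₂.mk ?_))
    have hx : Primrec fun p : ((ℕ × Bool) × Word) × (ℕ × Bool) × Word => p.1.1 :=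
      Primrec.fst.comp Primrec.fst
    have hy : Primrec fun p : ((ℕ × Bool) × Word) × (ℕ × Bool) × Word => p.2.1 :=
      Primrec.fst.comp Primrec.snd
    have ht : Primrec fun p : ((ℕ × Bool) × Word) × (ℕ × Bool) × Word => p.2.2 :=
      Primrec.snd.comp Primrec.snd
    exact Primrec.ite
      ((Primrec.eq.comp (Primrec.fst.comp hx) (Primrec.fst.comp hy)).and
        (Primrec.eq.comp (Primrec.snd.comp hx) (Primrec.not.comp (Primrec.snd.comp hy))))
      ht (Primrec.list_cons.comp hx (Primrec.list_cons.comp hy ht))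
  refine (Primrec.list_foldr (f := fun w : Word => w) (g := fun _ => [])
    (h := fun _ p => step p.1 p.2) Primrec.id (Primrec.const [])
    (Primrec.to₂ (hs.comp (Primrec.fst.comp Primrec.snd) (Primrec.snd.comp Primrec.snd)))).of_eq ?_
  intro w
  induction w with
  | nil => rfl
  | cons x t ih => rw [List.foldr_cons, ih, FreeGroup.reduce.cons]

theorem primrecPred_coneClause {P Z : α → Word → Prop} (hP : PrimrecRel P) (hZ : PrimrecRel Z)
    {u v : α → Word} (hu : Primrec u) (hv : Primrec v) :
    PrimrecPred fun a => ConeClause (P a) (Z a) (u a) (v a) := by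
  have app : ∀ {f g : α → Word}, Primrec f → Primrec g → Primrec fun a => f a ++ g a :=
    fun hf hg => Primrec.list_append.comp hf hg
  have hPu := hP.comp Primrec.id hu
  have hPv := hP.comp Primrec.id hv
  have hPuv := hP.comp Primrec.id (app hu hv)
  have hPc := hP.comp Primrec.id (app (app hv hu) (primrec_invRev.comp hv))
  have hPi := hP.comp Primrec.id (primrec_invRev.comp hu)
  have hZu := hZ.comp Primrec.id hu
  refine ((hPu.not.or (hPv.not.or hPuv)).and ((hPu.not.or hPc).and ((hZu.not.or hPu.not).and
    (hZu.or (hPu.or hPi))))).of_eq fun a => ?_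
  simp only [ConeClause, id, imp_iff_not_or]

end Primrec

/-! ### Certificates for words representing the identity -/

/-- `IsRelator i r` if `r` is the word of a relator of the presentation with index `i`, or a letter
which is not a generator of this presentation. -/
def IsRelator (i : ℕ) (r : Word) : Prop :=
  Encodable.encode r ∈ ceSet i.unpair.2 ∨ ∃ n, r = [(n, true)] ∧ 0 ∈ phi i.unpair.1 n

/-- A tuple `(u, b, r, n, k)` standing for the conjugate by `u` of the relator `r` (if `b` is true)
or of its inverse; `k` bounds a computation which shows that `r` is a relator, and `n` is the letter
in `r` if `r` consists of a letter which is not a generator. -/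
abbrev Conjugate : Type := Word × Bool × Word × ℕ × ℕ

/-- The word of a conjugate of a relator. -/
def conjugateWord (e : Conjugate) : Word :=
  e.1 ++ cond e.2.1 e.2.2.1 (FreeGroup.invRev e.2.2.1) ++ FreeGroup.invRev e.1

/-- The computation described by `e` shows that `e` is the conjugate of a relator. -/
def IsVerified (i : ℕ) (e : Conjugate) : Prop :=
  (Code.evaln e.2.2.2.2 (Denumerable.ofNat Code i.unpair.2) (Encodable.encode e.2.2.1)).isSome = true
    ∨ e.2.2.1 = [(e.2.2.2.1, true)] ∧
      Code.evaln e.2.2.2.2 (Denumerable.ofNat Code i.unpair.1) e.2.2.2.1 = some 0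

/-- The list `c` of conjugates of relators of the presentation with index `i` shows that the word
`w` represents the identity. -/
def Certifies (i : ℕ) (c : List Conjugate) (w : Word) : Prop :=
  (∀ e ∈ c, IsVerified i e) ∧ FreeGroup.reduce w = FreeGroup.reduce (c.flatMap conjugateWord)

theorem isRelator_of_isVerified {i : ℕ} {e : Conjugate} (h : IsVerified i e) :
    IsRelator i e.2.2.1 := by
  rcases h with h | ⟨h1, h2⟩
  · obtain ⟨x, hx⟩ := Option.isSome_iff_exists.1 h
    exact Or.inl (Part.dom_iff_mem.2 ⟨x, Code.evaln_sound hx⟩)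
  · exact Or.inr ⟨_, h1, Code.evaln_sound h2⟩

theorem exists_isVerified {i : ℕ} {r : Word} (h : IsRelator i r) :
    ∃ n k, ∀ u b, IsVerified i (u, b, r, n, k) := by
  rcases h with h | ⟨n, h1, h2⟩
  · obtain ⟨x, hx⟩ := Part.dom_iff_mem.1 h
    obtain ⟨k, hk⟩ := Code.evaln_complete.1 hx
    exact ⟨0, k, fun _ _ => Or.inl (Option.isSome_iff_exists.2 ⟨x, hk⟩)⟩
  · obtain ⟨k, hk⟩ := Code.evaln_complete.1 h2
    exact ⟨n, k, fun _ _ => Or.inr ⟨h1, hk⟩⟩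

theorem mk_flatMap_conjugateWord (c : List Conjugate) :
    FreeGroup.mk (c.flatMap conjugateWord) =
      (c.map fun e => FreeGroup.mk (conjugateWord e)).prod := by
  induction c with
  | nil => rfl
  | cons e c ih =>
    rw [List.flatMap_cons, ← FreeGroup.mul_mk, ih, List.map_cons, List.prod_cons]

theorem mk_conjugateWord (e : Conjugate) :
    FreeGroup.mk (conjugateWord e) = FreeGroup.mk e.1 *
      (cond e.2.1 (FreeGroup.mk e.2.2.1) (FreeGroup.mk e.2.2.1)⁻¹) * (FreeGroup.mk e.1)⁻¹ := by
  rw [conjugateWord, ← FreeGroup.mul_mk, ← FreeGroup.mul_mk, ← FreeGroup.inv_mk]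
  cases e.2.1 <;> simp [FreeGroup.inv_mk]

/-- The words which represent the identity are those with a certificate. -/
theorem mem_normalClosure_iff_certifies (i : ℕ) (w : Word) :
    FreeGroup.mk w ∈ Subgroup.normalClosure {x | ∃ r, IsRelator i r ∧ FreeGroup.mk r = x} ↔
      ∃ c, Certifies i c w := by
  constructor
  · suffices h : ∀ x ∈ Subgroup.normalClosure {x | ∃ r, IsRelator i r ∧ FreeGroup.mk r = x},
        ∃ c : List Conjugate, (∀ e ∈ c, IsVerified i e) ∧
          x = (c.map fun e => FreeGroup.mk (conjugateWord e)).prod by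
      intro hw
      obtain ⟨c, hc, hx⟩ := h _ hw
      exact ⟨c, hc, FreeGroup.reduce.sound (hx.trans (mk_flatMap_conjugateWord c).symm)⟩
    intro x hx
    induction hx using Subgroup.closure_induction with
    | mem x hx =>
      obtain ⟨_, ⟨r, hr, rfl⟩, hx⟩ := Group.mem_conjugatesOfSet_iff.1 hx
      obtain ⟨g, rfl⟩ := isConj_iff.1 hx
      obtain ⟨n, k, hnk⟩ := exists_isVerified hr
      refine ⟨[(g.toWord, true, r, n, k)], by simpa using hnk _ _, ?_⟩
      simp only [List.map_cons, List.map_nil, List.prod_singleton, mk_conjugateWord,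
        FreeGroup.mk_toWord, cond_true]
    | one => exact ⟨[], by simp, rfl⟩
    | mul x y _ _ ihx ihy =>
      obtain ⟨c, hc, rfl⟩ := ihx
      obtain ⟨d, hd, rfl⟩ := ihy
      refine ⟨c ++ d, fun e he => ?_, by simp⟩
      exact (List.mem_append.1 he).elim (hc e) (hd e)
    | inv x _ ih =>
      obtain ⟨c, hc, rfl⟩ := ih
      -- A product of conjugates is inverted by reversing the list and flipping each sign; the
      -- verified data are untouched.
      refine ⟨(c.map fun e => (e.1, !e.2.1, e.2.2)).reverse, fun e he => ?_, ?_⟩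
      · obtain ⟨e', he', rfl⟩ := List.mem_map.1 (List.mem_reverse.1 he)
        exact hc e' he'
      · rw [List.prod_inv_reverse, List.map_reverse, List.map_map, List.map_map]
        congr 2
        refine List.map_congr_left fun e _ => ?_
        simp only [Function.comp, mk_conjugateWord]
        cases e.2.1 <;> simp
  · rintro ⟨c, hc, hw⟩
    rw [FreeGroup.reduce.exact hw, mk_flatMap_conjugateWord]
    refine Subgroup.list_prod_mem _ fun x hx => ?_
    obtain ⟨e, he, rfl⟩ := List.mem_map.1 hx
    have hr : FreeGroup.mk e.2.2.1 ∈
        Subgroup.normalClosure {x | ∃ r, IsRelator i r ∧ FreeGroup.mk r = x} :=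
      Subgroup.subset_normalClosure ⟨_, isRelator_of_isVerified (hc e he), rfl⟩
    rw [mk_conjugateWord]
    refine Subgroup.normalClosure_normal.conj_mem _ ?_ _
    cases e.2.1
    · exact inv_mem hr
    · exact hr

theorem primrecRel_isVerified : PrimrecRel IsVerified := by
  have ofN : Primrec (Denumerable.ofNat Code) := Primrec.ofNat _
  have hr : Primrec fun p : ℕ × Conjugate => p.2.2.2.1 :=
    Primrec.fst.comp (Primrec.snd.comp (Primrec.snd.comp Primrec.snd))
  have hn : Primrec fun p : ℕ × Conjugate => p.2.2.2.2.1 :=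
    Primrec.fst.comp (Primrec.snd.comp (Primrec.snd.comp (Primrec.snd.comp Primrec.snd)))
  have hk : Primrec fun p : ℕ × Conjugate => p.2.2.2.2.2 :=
    Primrec.snd.comp (Primrec.snd.comp (Primrec.snd.comp (Primrec.snd.comp Primrec.snd)))
  have hi : Primrec fun p : ℕ × Conjugate => p.1.unpair := Primrec.unpair.comp Primrec.fst
  have h1 := Code.primrec_evaln.comp
    ((hk.pair (ofN.comp (Primrec.snd.comp hi))).pair (Primrec.encode.comp hr))
  have h2 := Code.primrec_evaln.comp ((hk.pair (ofN.comp (Primrec.fst.comp hi))).pair hn)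
  exact (Primrec.eq.comp (Primrec.option_isSome.comp h1) (Primrec.const true)).or
    ((Primrec.eq.comp hr (Primrec.list_cons.comp (hn.pair (Primrec.const true))
      (Primrec.const []))).and (Primrec.eq.comp h2 (Primrec.const (some 0))))

theorem primrec_conjugateWord : Primrec conjugateWord := by
  have hr : Primrec fun e : Conjugate => e.2.2.1 :=
    Primrec.fst.comp (Primrec.snd.comp Primrec.snd)
  exact Primrec.list_append.comp (Primrec.list_append.comp Primrec.fst
    (Primrec.cond (Primrec.fst.comp Primrec.snd) hr (primrec_invRev.comp hr)))
    (primrec_invRev.comp Primrec.fst)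

theorem primrecPred_certifies :
    PrimrecPred fun p : ℕ × List Conjugate × Word => Certifies p.1 p.2.1 p.2.2 := by
  have h1 : PrimrecRel fun (c : List Conjugate) (i : ℕ) => ∀ e ∈ c, IsVerified i e :=
    PrimrecRel.forall_mem_list (primrecRel_isVerified.comp Primrec.snd Primrec.fst)
  exact (h1.comp (Primrec.fst.comp Primrec.snd) Primrec.fst).and
    (Primrec.eq.comp (primrec_reduce.comp (Primrec.snd.comp Primrec.snd))
      (primrec_reduce.comp (Primrec.list_flatMap (Primrec.fst.comp Primrec.snd)
        (Primrec.to₂ (primrec_conjugateWord.comp Primrec.snd)))))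

/-! ### Presented groups as quotients of the free group on `ℕ` -/

/-- The homomorphism from the free group on `ℕ` to the group with index `i` which sends the
generators to themselves, and the other natural numbers to the identity. -/
noncomputable def wordHom (i : ℕ) : FreeGroup ℕ →* groupOf i :=
  open Classical in
  FreeGroup.lift fun n => if h : n ∈ generators i then PresentedGroup.of ⟨n, h⟩ else 1

theorem wordHom_of_mem {i n : ℕ} (h : n ∈ generators i) :
    wordHom i (FreeGroup.of n) = PresentedGroup.of ⟨n, h⟩ := by
  simp [wordHom, h]

theorem wordHom_of_not_mem {i n : ℕ} (h : n ∉ generators i) : wordHom i (FreeGroup.of n) = 1 := by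
  simp [wordHom, h]

theorem wordHom_map (i : ℕ) (x : FreeGroup (generators i)) :
    wordHom i (FreeGroup.map Subtype.val x) = PresentedGroup.mk (relators i) x := by
  have : (wordHom i).comp (FreeGroup.map Subtype.val) = PresentedGroup.mk (relators i) :=
    FreeGroup.ext_hom _ _ fun a => by simp [wordHom_of_mem a.2, PresentedGroup.of]
  exact DFunLike.congr_fun this x

theorem wordHom_surjective (i : ℕ) : Function.Surjective (wordHom i) := fun g => by
  obtain ⟨x, rfl⟩ := PresentedGroup.mk_surjective _ g
  exact ⟨_, wordHom_map i x⟩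

/-- Each inclusion is a universal property. The letters outside the generating set must be killed
too, and they can be enumerated because `phi` takes the value `0` at them. -/
theorem wordHom_eq_one_iff {i : ℕ} (hi : IsPresentationIndex i) (x : FreeGroup ℕ) :
    wordHom i x = 1 ↔
      x ∈ Subgroup.normalClosure {x | ∃ r, IsRelator i r ∧ FreeGroup.mk r = x} := by
  set N := Subgroup.normalClosure {x | ∃ r, IsRelator i r ∧ FreeGroup.mk r = x} with hN
  have hgen : ∀ n, n ∉ generators i ↔ 0 ∈ phi i.unpair.1 n := fun n => by
    rcases hi.1 n with h | h <;> simp [generators, h]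
  constructor
  · have hrel : ∀ r ∈ relators i, FreeGroup.lift
        (fun a : generators i => (QuotientGroup.mk' N) (FreeGroup.of (a : ℕ))) r = 1 := by
      rintro _ ⟨w, hw, rfl⟩
      have h1 : FreeGroup.lift
          (fun a : generators i => (QuotientGroup.mk' N) (FreeGroup.of (a : ℕ))) =
          (QuotientGroup.mk' N).comp (FreeGroup.map Subtype.val) :=
        FreeGroup.ext_hom _ _ fun a => by simp
      rw [h1, MonoidHom.comp_apply, FreeGroup.map.mk]
      exact (QuotientGroup.eq_one_iff _).2 (Subgroup.subset_normalClosure ⟨_, Or.inl hw, rfl⟩)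
    -- The quotient map by `N` factors through `wordHom i`, so the kernel of the latter lies in `N`.
    have h2 : (PresentedGroup.toGroup hrel).comp (wordHom i) = QuotientGroup.mk' N := by
      refine FreeGroup.ext_hom _ _ fun n => ?_
      by_cases hn : n ∈ generators i
      · rw [MonoidHom.comp_apply, wordHom_of_mem hn, PresentedGroup.toGroup.of]
      · rw [MonoidHom.comp_apply, wordHom_of_not_mem hn, map_one]
        exact ((QuotientGroup.eq_one_iff (N := N) (FreeGroup.of n)).2
          (Subgroup.subset_normalClosure ⟨[(n, true)], Or.inr ⟨n, rfl, (hgen n).1 hn⟩, rfl⟩)).symm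
    intro hx
    refine (QuotientGroup.eq_one_iff _).1 ?_
    have h3 := DFunLike.congr_fun h2 x
    rw [MonoidHom.comp_apply, hx, map_one] at h3
    exact h3.symm
  · suffices h : N ≤ (wordHom i).ker from fun hx => h hx
    refine Subgroup.normalClosure_le_normal ?_
    rintro _ ⟨r, hr | ⟨n, rfl, hn⟩, rfl⟩
    · obtain ⟨w, rfl⟩ : ∃ w : List (generators i × Bool), w.map (fun p => ((p.1 : ℕ), p.2)) = r := by
        obtain ⟨w, hw⟩ := hi.2 _ hr
        exact ⟨w, Encodable.encode_injective hw⟩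
      have h1 := wordHom_map i (FreeGroup.mk w)
      rw [FreeGroup.map.mk] at h1
      exact MonoidHom.mem_ker.2 (h1.trans (PresentedGroup.one_of_mem ⟨w, hr, rfl⟩))
    · exact MonoidHom.mem_ker.2 (wordHom_of_not_mem ((hgen n).2 hn))

/-! ### The upper bound -/

/-- Within the indices of recursive presentations, bi-orderability is `Π⁰₂`. -/
theorem exists_isPi02_biOrderable :
    ∃ S : Set ℕ, IsPi02 S ∧ ∀ i, IsPresentationIndex i → (i ∈ S ↔ BiOrderable (groupOf i)) := by
  let Z : ℕ → List (List Conjugate) → Word → Prop := fun i T w => ∃ c ∈ T, Certifies i c w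
  -- The arguments are the index, the pair `(L, T)` under the universal quantifier, and the pair of
  -- `T'` and the finite set of positive words under the existential one.
  let R : ℕ × (List (Word × Word) × List (List Conjugate)) ×
      (List (List Conjugate) × List Word) → Prop := fun p =>
    ∀ q ∈ p.2.1.1, ConeClause (· ∈ p.2.2.2) (Z p.1 (p.2.1.2 ++ p.2.2.1)) q.1 q.2
  refine ⟨{i | ∀ a, ∃ b, R (i, a, b)}, isPi02_of_primrecPred (R := R) ?_ fun e => Iff.rfl, ?_⟩
  · have hZ : PrimrecRel fun (T : List (List Conjugate)) (p : ℕ × Word) => Z p.1 T p.2 :=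
      PrimrecRel.exists_mem_list (primrecPred_certifies.comp
        ((Primrec.fst.comp Primrec.snd).pair (Primrec.fst.pair (Primrec.snd.comp Primrec.snd))))
    have hmem : PrimrecRel fun (σ : List Word) (w : Word) => w ∈ σ :=
      (PrimrecRel.exists_mem_list (R := fun a b : Word => a = b) Primrec.eq).of_eq (by simp)
    have hC : PrimrecRel fun (q : Word × Word)
        (p : ℕ × (List (Word × Word) × List (List Conjugate)) ×
          (List (List Conjugate) × List Word)) =>
        ConeClause (· ∈ p.2.2.2) (Z p.1 (p.2.1.2 ++ p.2.2.1)) q.1 q.2 := by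
      have hp : Primrec fun s : ((Word × Word) × ℕ × (List (Word × Word) × List (List Conjugate)) ×
          (List (List Conjugate) × List Word)) × Word => s.1.2 := Primrec.snd.comp Primrec.fst
      refine primrecPred_coneClause (P := fun (s : (Word × Word) × ℕ × (List (Word × Word) × List (List Conjugate)) ×
          (List (List Conjugate) × List Word)) w => w ∈ s.2.2.2.2)
        (Z := fun s w => Z s.2.1 (s.2.2.1.2 ++ s.2.2.2.1) w) ?_ ?_
        (Primrec.fst.comp Primrec.fst) (Primrec.snd.comp Primrec.fst)
      · exact hmem.comp (Primrec.snd.comp (Primrec.snd.comp (Primrec.snd.comp hp))) Primrec.snd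
      · exact hZ.comp (Primrec.list_append.comp
          (Primrec.snd.comp (Primrec.fst.comp (Primrec.snd.comp hp)))
          (Primrec.fst.comp (Primrec.snd.comp (Primrec.snd.comp hp))))
          ((Primrec.fst.comp hp).pair Primrec.snd)
    exact (PrimrecRel.forall_mem_list hC).comp
      (Primrec.fst.comp (Primrec.fst.comp Primrec.snd)) Primrec.id
  · intro i hi
    have hZ : ∀ w, wordHom i (FreeGroup.mk w) = 1 ↔ ∃ c, Certifies i c w := fun w =>
      (wordHom_eq_one_iff hi _).trans (mem_normalClosure_iff_certifies i w)
    have hT : ∀ L : List (Word × Word), ∃ T : List (List Conjugate), ∀ T', ∀ q ∈ L,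
        (Z i (T ++ T') q.1 ↔ wordHom i (FreeGroup.mk q.1) = 1) := by
      intro L
      -- For words not representing the identity the value of `cert` is arbitrary and certifies
      -- nothing.
      choose! cert hcert using fun w => (hZ w).1
      refine ⟨L.map fun q => cert q.1, fun T' q hq => ⟨fun ⟨c, _, hc⟩ => (hZ _).2 ⟨c, hc⟩, fun h =>
        ⟨cert q.1, List.mem_append_left _ (List.mem_map_of_mem hq), hcert _ h⟩⟩⟩
    have hT' : ∀ (L : List (Word × Word)) (T : List (List Conjugate)), ∃ T', ∀ q ∈ L,
        (Z i (T ++ T') q.1 ↔ wordHom i (FreeGroup.mk q.1) = 1) := by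
      intro L T
      obtain ⟨T', hT'⟩ := hT L
      refine ⟨T', fun q hq => ⟨fun ⟨c, _, hc⟩ => (hZ _).2 ⟨c, hc⟩, fun h => ?_⟩⟩
      obtain ⟨c, hc, hcw⟩ := (hT' [] q hq).2 h
      exact ⟨c, List.mem_append_right _ (by simpa using hc), hcw⟩
    rw [biOrderable_iff_coneClause (wordHom i) (wordHom_surjective i)]
    constructor
    · intro h
      refine exists_forall_coneClause fun L => ?_
      -- This `T` certifies every identity occurring as the first word of a clause in `L`, so
      -- whatever `T'` is answered, the approximation to `Z` is exact there.
      obtain ⟨T, hT⟩ := hT L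
      obtain ⟨⟨T', σ⟩, hσ⟩ := h (L, T)
      exact ⟨(· ∈ σ), fun q hq => (coneClause_congr Iff.rfl Iff.rfl Iff.rfl Iff.rfl Iff.rfl
        (hT T' q hq)).1 (hσ q hq)⟩
    · rintro ⟨P, hP⟩ ⟨L, T⟩
      classical
      obtain ⟨T', hT'⟩ := hT' L T
      -- All the words at which a clause evaluates `P`; the finite assignment is `P` restricted to
      -- these.
      let pts : Word × Word → List Word := fun q =>
        [q.1, q.2, q.1 ++ q.2, q.2 ++ q.1 ++ FreeGroup.invRev q.2, FreeGroup.invRev q.1]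
      refine ⟨(T', (L.flatMap pts).filter fun w => decide (P w)), fun q hq => ?_⟩
      have hpts : ∀ w ∈ pts q, (w ∈ (L.flatMap pts).filter (fun w => decide (P w)) ↔ P w) := by
        intro w hw
        rw [List.mem_filter, decide_eq_true_iff, and_iff_right_iff_imp]
        exact fun _ => List.mem_flatMap.2 ⟨q, hq, hw⟩
      exact (coneClause_congr (hpts _ (by simp [pts])) (hpts _ (by simp [pts]))
        (hpts _ (by simp [pts])) (hpts _ (by simp [pts])) (hpts _ (by simp [pts]))
        (hT' q hq)).2 (hP q.1 q.2)

/-! ### The Klein bottle group and orders on its powers -/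

/-- The fundamental group `⟨a, b | a b a⁻¹ = b⁻¹⟩` of the Klein bottle. The pair `(k, m)` stands for
`a ^ k * b ^ m`. -/
@[ext]
structure KleinBottleGroup where
  /-- The exponent of `a`. -/
  k : ℤ
  /-- The exponent of `b`. -/
  m : ℤ

namespace KleinBottleGroup

-- Moving `b ^ m` to the right past `a ^ k` turns it into `b ^ ((-1) ^ k * m)`.
instance : Mul KleinBottleGroup := ⟨fun g h => ⟨g.k + h.k, h.k.negOnePow * g.m + h.m⟩⟩

instance : One KleinBottleGroup := ⟨⟨0, 0⟩⟩

instance : Inv KleinBottleGroup := ⟨fun g => ⟨-g.k, -(g.k.negOnePow * g.m)⟩⟩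

@[simp] theorem mul_k (g h : KleinBottleGroup) : (g * h).k = g.k + h.k := rfl

@[simp] theorem mul_m (g h : KleinBottleGroup) :
    (g * h).m = h.k.negOnePow * g.m + h.m := rfl

@[simp] theorem one_k : (1 : KleinBottleGroup).k = 0 := rfl

@[simp] theorem one_m : (1 : KleinBottleGroup).m = 0 := rfl

@[simp] theorem inv_k (g : KleinBottleGroup) : g⁻¹.k = -g.k := rfl

@[simp] theorem inv_m (g : KleinBottleGroup) : g⁻¹.m = -(g.k.negOnePow * g.m) := rfl

theorem negOnePow_mul_self (k : ℤ) : ((k.negOnePow : ℤ) * k.negOnePow : ℤ) = 1 := by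
  rw [← Units.val_mul, Int.units_mul_self, Units.val_one]

instance : Group KleinBottleGroup :=
  Group.ofLeftAxioms
    (fun g h j => by
      ext
      · simp [add_assoc]
      · simp only [mul_m, mul_k, Int.negOnePow_add, Units.val_mul]
        ring)
    (fun g => by ext <;> simp)
    (fun g => by
      ext
      · simp
      · have := negOnePow_mul_self g.k
        simp only [mul_m, inv_m, one_m]
        linear_combination -g.m * this)

/-- The positive cone of the lexicographic left-order. -/
def positiveCone : Set KleinBottleGroup := {g | 0 < g.k ∨ g.k = 0 ∧ 0 < g.m}

/-- The exponents of `b` matter only when both exponents of `a` vanish, and then multiplication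
involves no sign. -/
theorem mul_mem_positiveCone {g h : KleinBottleGroup} (hg : g ∈ positiveCone)
    (hh : h ∈ positiveCone) : g * h ∈ positiveCone := by
  rcases hg with hg | ⟨hg, hg'⟩ <;> rcases hh with hh | ⟨hh, hh'⟩
  · exact Or.inl (add_pos hg hh)
  · exact Or.inl (by simpa [hh] using hg)
  · exact Or.inl (by simpa [hg] using hh)
  · exact Or.inr ⟨by simp [hg, hh], by simpa [hh] using add_pos hg' hh'⟩

theorem one_not_mem_positiveCone : (1 : KleinBottleGroup) ∉ positiveCone := by
  simp [positiveCone]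

theorem mem_positiveCone_or_inv_mem {g : KleinBottleGroup} (hg : g ≠ 1) :
    g ∈ positiveCone ∨ g⁻¹ ∈ positiveCone := by
  rcases lt_trichotomy g.k 0 with h | h | h
  · exact Or.inr (Or.inl (by simpa using h))
  · rcases lt_trichotomy g.m 0 with h' | h' | h'
    · exact Or.inr (Or.inr ⟨by simp [h], by simpa [h] using h'⟩)
    · exact absurd (KleinBottleGroup.ext h h') hg
    · exact Or.inl (Or.inr ⟨h, h'⟩)
  · exact Or.inl (Or.inl h)

end KleinBottleGroup

/-- The sign of an element is read off at its first nontrivial coordinate, which exists since `ℕ` is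
well-ordered. -/
theorem leftOrderable_pi_kleinBottleGroup : LeftOrderable (ℕ → KleinBottleGroup) := by
  classical
  refine leftOrderable_of_cone
    {g | ∃ x, (∀ y < x, g y = 1) ∧ g x ∈ KleinBottleGroup.positiveCone} ?_ ?_ ?_
  · rintro g ⟨x, hx, hgx⟩ h ⟨y, hy, hhy⟩
    rcases lt_trichotomy x y with hxy | rfl | hxy
    · exact ⟨x, fun z hz => by simp [hx z hz, hy z (hz.trans hxy)], by simpa [hy x hxy] using hgx⟩
    · exact ⟨x, fun z hz => by simp [hx z hz, hy z hz],
        KleinBottleGroup.mul_mem_positiveCone hgx hhy⟩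
    · exact ⟨y, fun z hz => by simp [hx z (hz.trans hxy), hy z hz], by simpa [hx y hxy] using hhy⟩
  · rintro ⟨x, -, hx⟩
    exact KleinBottleGroup.one_not_mem_positiveCone hx
  · intro g
    by_cases hg : g = 1
    · exact Or.inl hg
    · have hex : ∃ x, g x ≠ 1 := Function.ne_iff.1 hg
      have hmin : ∀ y < Nat.find hex, g y = 1 := fun y hy => not_not.1 (Nat.find_min hex hy)
      rcases KleinBottleGroup.mem_positiveCone_or_inv_mem (Nat.find_spec hex) with h | h
      · exact Or.inr (Or.inl ⟨_, hmin, h⟩)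
      · exact Or.inr (Or.inr ⟨_, fun y hy => by simp [hmin y hy], h⟩)

theorem LeftOrderable.of_injective {G H : Type*} [Group G] [Group H] (hH : LeftOrderable H)
    (f : G →* H) (hf : Function.Injective f) : LeftOrderable G := by
  obtain ⟨o, ho⟩ := hH
  refine ⟨LinearOrder.lift' f hf, fun a g h hgh => ?_⟩
  change f (a * g) ≤ f (a * h)
  rw [map_mul, map_mul]
  exact ho _ _ _ hgh

theorem LeftOrderable.biOrderable_of_commute {G : Type*} [Group G] (hG : LeftOrderable G)
    (hc : ∀ g h : G, g * h = h * g) : BiOrderable G := by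
  obtain ⟨o, ho⟩ := hG
  exact ⟨o, ho, fun a g h hgh => by rw [hc g a, hc h a]; exact ho a g h hgh⟩

/-- In a bi-orderable group only the identity is conjugate to its inverse. -/
theorem BiOrderable.eq_one_of_conj_eq_inv {G : Type*} [Group G] (hG : BiOrderable G) {a b : G}
    (h : a * b * a⁻¹ = b⁻¹) : b = 1 := by
  obtain ⟨o, hl, hr⟩ := hG
  rcases le_total b 1 with hb | hb
  · have h1 := hr a⁻¹ _ _ (hl a _ _ hb)
    have h2 := hl b _ _ h1
    rw [h] at h2
    exact le_antisymm hb (by simpa using h2)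
  · have h1 := hr a⁻¹ _ _ (hl a _ _ hb)
    have h2 := hl b _ _ h1
    rw [h] at h2
    exact le_antisymm (by simpa using h2) hb

/-! ### Deciding words in the modified product -/

section Letters

variable (T : ℕ → Prop)

open Classical in
/-- The image of the generator `n` in the product of copies of the Klein bottle group: for `n = 2x`
and `n = 2x + 1` the generators `a` and `b` of the copy with index `x`, except that `b` is replaced
by the identity if `T x`. -/
noncomputable def letterImage (n : ℕ) : ℕ → KleinBottleGroup := fun x =>
  if n.div2 = x then bif n.bodd then ⟨0, if T x then 0 else 1⟩ else ⟨1, 0⟩ else 1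

/-- The homomorphism from the free group on `ℕ` to the product of copies of the Klein bottle group
which is given by `letterImage`. -/
noncomputable def kleinHom : FreeGroup ℕ →* (ℕ → KleinBottleGroup) :=
  FreeGroup.lift (letterImage T)

/-- The effect of a letter on four numbers `(p, q, r, s)` which stand for `a ^ (p - q) b ^ (r - s)`
in the copy of the Klein bottle group with index `x`. -/
def letterStep (x : ℕ) (t : ℕ × ℕ × ℕ × ℕ) (l : ℕ × Bool) : ℕ × ℕ × ℕ × ℕ :=
  if l.1.div2 = x then
    bif l.1.bodd then
      bif l.2 then (t.1, t.2.1, t.2.2.1 + 1, t.2.2.2) else (t.1, t.2.1, t.2.2.1, t.2.2.2 + 1)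
    else
      -- Appending `a` or `a⁻¹` inverts the power of `b`; swapping `r` and `s` does this without
      -- subtraction.
      bif l.2 then (t.1 + 1, t.2.1, t.2.2.2, t.2.2.1) else (t.1, t.2.1 + 1, t.2.2.2, t.2.2.1)
  else t

/-- The exponents of `a` and `b` in the value of a word in the copy with index `x`. -/
def wordExponents (x : ℕ) (w : Word) : ℕ × ℕ × ℕ × ℕ :=
  w.foldl (letterStep x) (0, 0, 0, 0)

open Classical in
/-- The element `a ^ (p - q) b ^ (r - s)`, or `a ^ (p - q)` if `T x`. -/
noncomputable def ofExponents (x : ℕ) (t : ℕ × ℕ × ℕ × ℕ) : KleinBottleGroup :=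
  ⟨(t.1 : ℤ) - t.2.1, if T x then 0 else (t.2.2.1 : ℤ) - t.2.2.2⟩

theorem ofExponents_letterStep (x : ℕ) (t : ℕ × ℕ × ℕ × ℕ) (l : ℕ × Bool) :
    ofExponents T x (letterStep x t l) = ofExponents T x t * kleinHom T (FreeGroup.mk [l]) x := by
  obtain ⟨n, b⟩ := l
  have h : kleinHom T (FreeGroup.mk [(n, b)]) x =
      cond b (letterImage T n x) (letterImage T n x)⁻¹ := by
    cases b <;> simp [kleinHom]
  rw [h]
  by_cases hx : n.div2 = x
  · by_cases hT : T x <;> cases hn : n.bodd <;> cases b <;>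
      ext <;> simp [letterImage, letterStep, ofExponents, hx, hn, hT] <;> ring
  · cases b <;> ext <;> simp [letterImage, letterStep, hx]

theorem kleinHom_apply (x : ℕ) (w : Word) :
    kleinHom T (FreeGroup.mk w) x = ofExponents T x (wordExponents x w) := by
  suffices h : ∀ t, ofExponents T x (w.foldl (letterStep x) t) =
      ofExponents T x t * kleinHom T (FreeGroup.mk w) x by
    have h0 : ofExponents T x (0, 0, 0, 0) = 1 := by ext <;> simp [ofExponents]
    rw [wordExponents, h, h0, one_mul]
  induction w with
  | nil =>
    intro t
    have : kleinHom T (FreeGroup.mk []) = 1 := map_one (kleinHom T)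
    simp [this]
  | cons l w ih =>
    intro t
    rw [List.foldl_cons, ih, ofExponents_letterStep, mul_assoc, ← Pi.mul_apply, ← map_mul,
      FreeGroup.mul_mk, List.singleton_append]

theorem letter_lt_encode {l : ℕ × Bool} {w : Word} (h : l ∈ w) : l.1 < Encodable.encode w := by
  induction w with
  | nil => simp at h
  | cons a w ih =>
    rw [Encodable.encode_list_cons, Nat.lt_succ_iff]
    rcases List.mem_cons.1 h with rfl | h
    · exact (Nat.left_le_pair _ _).trans (Nat.left_le_pair _ _)
    · exact (ih h).le.trans (Nat.right_le_pair _ _)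

/-- The letters of a word are smaller than its code, so a word affects only boundedly many copies.
-/
theorem wordExponents_of_encode_lt {x : ℕ} {w : Word} (h : Encodable.encode w < x) :
    wordExponents x w = (0, 0, 0, 0) := by
  have h' : ∀ l ∈ w, l.1.div2 ≠ x := fun l hl hx => by
    have h1 := letter_lt_encode hl
    have h2 := Nat.div2_val l.1
    omega
  clear h
  unfold wordExponents
  induction w with
  | nil => rfl
  | cons l w ih =>
    rw [List.foldl_cons, letterStep, if_neg (h' l List.mem_cons_self)]
    exact ih fun l hl => h' l (List.mem_cons_of_mem _ hl)

theorem ofExponents_eq_one_iff (x : ℕ) (t : ℕ × ℕ × ℕ × ℕ) :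
    ofExponents T x t = 1 ↔ t.1 = t.2.1 ∧ (t.2.2.1 = t.2.2.2 ∨ T x) := by
  rw [KleinBottleGroup.ext_iff]
  by_cases hT : T x <;> simp [ofExponents, hT, sub_eq_zero]

/-- The quantifier over copies becomes bounded and `T` occurs only positively, so the kernel is c.e.
when `T` is. -/
theorem kleinHom_eq_one_iff (w : Word) :
    kleinHom T (FreeGroup.mk w) = 1 ↔ ∀ x < Encodable.encode w + 1,
      (wordExponents x w).1 = (wordExponents x w).2.1 ∧
        ((wordExponents x w).2.2.1 = (wordExponents x w).2.2.2 ∨ T x) := by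
  simp only [← ofExponents_eq_one_iff, ← kleinHom_apply]
  refine ⟨fun h x _ => by rw [h, Pi.one_apply], fun h => funext fun x => ?_⟩
  rcases Nat.lt_or_ge x (Encodable.encode w + 1) with hx | hx
  · exact h x hx
  · rw [kleinHom_apply, wordExponents_of_encode_lt hx]
    exact (ofExponents_eq_one_iff T x _).2 ⟨rfl, Or.inl rfl⟩

variable {T}

theorem kleinHom_mul_comm (hT : ∀ x, T x) (g h : FreeGroup ℕ) :
    kleinHom T g * kleinHom T h = kleinHom T h * kleinHom T g := by
  funext x
  rw [← FreeGroup.mk_toWord (x := g), ← FreeGroup.mk_toWord (x := h), Pi.mul_apply, Pi.mul_apply,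
    kleinHom_apply, kleinHom_apply]
  ext <;> simp [ofExponents, hT x, add_comm]

theorem kleinHom_conj (T : ℕ → Prop) (x : ℕ) :
    kleinHom T (FreeGroup.of (2 * x) * FreeGroup.of (2 * x + 1) * (FreeGroup.of (2 * x))⁻¹ *
      FreeGroup.of (2 * x + 1)) = 1 := by
  funext y
  by_cases hy : x = y <;> by_cases hT : T y <;>
    ext <;> simp [kleinHom, letterImage, hy, hT, Nat.div2_val, Nat.bodd_succ, Nat.bodd_mul]

theorem kleinHom_of_ne_one {x : ℕ} (hx : ¬ T x) :
    kleinHom T (FreeGroup.of (2 * x + 1)) ≠ 1 := by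
  intro h
  have h1 := congrArg KleinBottleGroup.m (congrFun h x)
  simp [kleinHom, letterImage, hx] at h1

end Letters

/-! ### Uniform enumerability of the kernels -/

section Computability

variable {α : Type*} [Primcodable α]

theorem rePred_exists_nat {f : α × ℕ → Bool} (hf : Computable f) :
    REPred fun a => ∃ y, f (a, y) = true := by
  have h : Partrec fun a => Nat.rfind fun y => Part.some (f (a, y)) :=
    Partrec.rfind (Computable.partrec hf).to₂
  refine h.dom_re.of_eq fun a => ?_
  exact Nat.rfind_dom.trans ⟨fun ⟨y, hy, _⟩ => ⟨y, (Part.mem_some_iff.1 hy).symm⟩,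
    fun ⟨y, hy⟩ => ⟨y, Part.mem_some_iff.2 hy.symm, fun _ => trivial⟩⟩

/-- Running the semi-decision procedures one after another halts exactly when all of them do. -/
theorem rePred_forall_lt {Q : α × ℕ → Prop} (hQ : REPred Q) {N : α → ℕ} (hN : Computable N) :
    REPred fun a => ∀ x < N a, Q (a, x) := by
  have h : Partrec fun a => (N a).rec (Part.some ()) fun x IH => Part.bind IH fun _ =>
      Part.assert (Q (a, x)) fun _ => Part.some () :=
    Partrec.nat_rec (h := fun a p => Part.assert (Q (a, p.1)) fun _ => Part.some ()) hN
      (Computable.const ()).partrec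
      (Partrec.to₂ (f := fun q : α × ℕ × Unit => Part.assert (Q (q.1, q.2.1)) fun _ => Part.some ())
      (Partrec.comp hQ (Computable.fst.pair (Computable.fst.comp Computable.snd))))
  refine h.dom_re.of_eq fun a => ?_
  induction N a with
  | zero => simp
  | succ n ih =>
    rw [Nat.forall_lt_succ_right, ← ih]
    simp [Part.bind_dom, Part.assert]

theorem primrec_wordExponents : Primrec₂ wordExponents := by
  have hs : Primrec fun p : (ℕ × (ℕ × ℕ × ℕ × ℕ)) × ℕ × Bool => letterStep p.1.1 p.1.2 p.2 := by
    have ht : Primrec fun p : (ℕ × (ℕ × ℕ × ℕ × ℕ)) × ℕ × Bool => p.1.2 :=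
      Primrec.snd.comp Primrec.fst
    have hn : Primrec fun p : (ℕ × (ℕ × ℕ × ℕ × ℕ)) × ℕ × Bool => p.2.1 :=
      Primrec.fst.comp Primrec.snd
    have hb : Primrec fun p : (ℕ × (ℕ × ℕ × ℕ × ℕ)) × ℕ × Bool => p.2.2 :=
      Primrec.snd.comp Primrec.snd
    have h1 := Primrec.fst.comp ht
    have h2 := Primrec.fst.comp (Primrec.snd.comp ht)
    have h3 := Primrec.fst.comp (Primrec.snd.comp (Primrec.snd.comp ht))
    have h4 := Primrec.snd.comp (Primrec.snd.comp (Primrec.snd.comp ht))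
    exact Primrec.ite (Primrec.eq.comp (Primrec.nat_div2.comp hn) (Primrec.fst.comp Primrec.fst))
      (Primrec.cond (Primrec.nat_bodd.comp hn)
        (Primrec.cond hb (h1.pair (h2.pair ((Primrec.succ.comp h3).pair h4)))
          (h1.pair (h2.pair (h3.pair (Primrec.succ.comp h4)))))
        (Primrec.cond hb ((Primrec.succ.comp h1).pair (h2.pair (h4.pair h3)))
          (h1.pair ((Primrec.succ.comp h2).pair (h4.pair h3))))) ht
  exact Primrec.list_foldl (h := fun (p : ℕ × Word) q => letterStep p.1 q.1 q.2) Primrec.snd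
    (Primrec.const (0, 0, 0, 0)) (Primrec₂.mk (hs.comp
      (((Primrec.fst.comp Primrec.fst).pair (Primrec.fst.comp Primrec.snd)).pair
        (Primrec.snd.comp Primrec.snd))))

/-- If `T e x` is the projection of a computable relation, then the kernels of the homomorphisms
`kleinHom (T e)` are uniformly computably enumerable. -/
theorem rePred_kleinHom_eq_one {f : ℕ × ℕ × ℕ → Bool} (hf : Computable f) :
    REPred fun p : ℕ × ℕ => ∃ w : Word, Encodable.encode w = p.2 ∧
      kleinHom (fun x => ∃ y, f (p.1, x, y) = true) (FreeGroup.mk w) = 1 := by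
  let wd : ℕ → Word := fun n => (Encodable.decode n).getD []
  have hwd : Primrec wd := Primrec.option_getD.comp Primrec.decode (Primrec.const [])
  let g : ((ℕ × ℕ) × ℕ) × ℕ → Bool := fun p =>
    decide (Encodable.encode (wd p.1.1.2) = p.1.1.2) &&
      (decide ((wordExponents p.1.2 (wd p.1.1.2)).1 = (wordExponents p.1.2 (wd p.1.1.2)).2.1) &&
        (decide ((wordExponents p.1.2 (wd p.1.1.2)).2.2.1 =
          (wordExponents p.1.2 (wd p.1.1.2)).2.2.2) || f (p.1.1.1, p.1.2, p.2)))
  have hg : Computable g := by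
    have hn : Primrec fun p : ((ℕ × ℕ) × ℕ) × ℕ => p.1.1.2 :=
      Primrec.snd.comp (Primrec.fst.comp Primrec.fst)
    have hx : Primrec fun p : ((ℕ × ℕ) × ℕ) × ℕ => p.1.2 := Primrec.snd.comp Primrec.fst
    have hw := hwd.comp hn
    have ht := primrec_wordExponents.comp hx hw
    have h1 := (Primrec.eq.comp (Primrec.encode.comp hw) hn).decide
    have h2 := (Primrec.eq.comp (Primrec.fst.comp ht)
      (Primrec.fst.comp (Primrec.snd.comp ht))).decide
    have h3 := (Primrec.eq.comp (Primrec.fst.comp (Primrec.snd.comp (Primrec.snd.comp ht)))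
      (Primrec.snd.comp (Primrec.snd.comp (Primrec.snd.comp ht)))).decide
    have h4 : Computable fun p : ((ℕ × ℕ) × ℕ) × ℕ => f (p.1.1.1, p.1.2, p.2) :=
      hf.comp ((Primrec.fst.comp (Primrec.fst.comp Primrec.fst)).pair
        (hx.pair Primrec.snd)).to_comp
    exact Primrec.and.to_comp.comp h1.to_comp (Primrec.and.to_comp.comp h2.to_comp
      (Primrec.or.to_comp.comp h3.to_comp h4))
  refine (rePred_forall_lt (rePred_exists_nat hg)
    (N := fun p => p.2 + 1) (Primrec.succ.comp Primrec.snd).to_comp).of_eq ?_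
  rintro ⟨e, n⟩
  simp only [kleinHom_eq_one_iff]
  constructor
  · intro h
    have hn : Encodable.encode (wd n) = n := by
      -- The bound is `n + 1`, so `x = 0` is always tested and the check that `n` codes a word is
      -- never skipped.
      obtain ⟨y, hy⟩ := h 0 (Nat.succ_pos n)
      simp only [g, Bool.and_eq_true, decide_eq_true_eq] at hy
      exact hy.1
    refine ⟨wd n, hn, fun x hx => ?_⟩
    rw [hn] at hx
    obtain ⟨y, hy⟩ := h x hx
    simp only [g, Bool.and_eq_true, Bool.or_eq_true, decide_eq_true_eq] at hy
    exact ⟨hy.2.1, hy.2.2.imp_right fun h => ⟨y, h⟩⟩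
  · rintro ⟨w, rfl, hw⟩ x hx
    have hwd' : wd (Encodable.encode w) = w := by simp [wd]
    simp only [g, Bool.and_eq_true, Bool.or_eq_true, decide_eq_true_eq, hwd']
    obtain ⟨h1, h2 | ⟨y, h2⟩⟩ := hw x hx
    · exact ⟨0, trivial, h1, Or.inl h2⟩
    · exact ⟨y, trivial, h1, Or.inr h2⟩

/-- A uniformly computably enumerable family of sets has a computable family of indices. -/
theorem exists_computable_ceSet {Q : ℕ × ℕ → Prop} (hQ : REPred Q) :
    ∃ d : ℕ → ℕ, Computable d ∧ ∀ e, ceSet (d e) = {n | Q (e, n)} := by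
  have h : Partrec fun z : ℕ => (Part.assert (Q z.unpair) fun _ => Part.some ()).map fun _ => 0 :=
    (Partrec.comp hQ Computable.unpair).map (Computable.const 0).to₂
  obtain ⟨c, hc⟩ := Nat.Partrec.Code.exists_code.1 (Partrec.nat_iff.1 h)
  -- Currying one code for the whole family is the s-m-n theorem.
  refine ⟨fun e => Encodable.encode (c.curry e), (Primrec.encode.comp
    (Nat.Partrec.Code.primrec₂_curry.comp (Primrec.const c) Primrec.id)).to_comp, fun e => ?_⟩
  ext n
  simp [ceSet, phi, Nat.Partrec.Code.eval_curry, hc, Part.assert]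

end Computability

/-! ### Presentations with all words of a kernel as relators -/

section AllGenerators

variable {i : ℕ} {M : Type*} [Group M] {φ : FreeGroup ℕ →* M}

theorem isPresentationIndex_of_forall (h1 : ∀ n, phi i.unpair.1 n = Part.some 1)
    (h2 : ceSet i.unpair.2 = {n | ∃ w : Word, Encodable.encode w = n ∧ φ (FreeGroup.mk w) = 1}) :
    IsPresentationIndex i := by
  refine ⟨fun n => Or.inr (h1 n), fun n hn => ?_⟩
  rw [h2] at hn
  obtain ⟨w, rfl, -⟩ := hn
  refine ⟨w.map fun l => (⟨l.1, by simp [generators, h1]⟩, l.2), ?_⟩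
  simp [wordCode, Function.comp_def]

/-- If the relators are all words in the kernel of `φ`, then the words representing the identity in
the presented group are those in the kernel of `φ`. -/
theorem wordHom_eq_one_iff_of_forall (h1 : ∀ n, phi i.unpair.1 n = Part.some 1)
    (h2 : ceSet i.unpair.2 = {n | ∃ w : Word, Encodable.encode w = n ∧ φ (FreeGroup.mk w) = 1})
    (x : FreeGroup ℕ) : wordHom i x = 1 ↔ φ x = 1 := by
  -- The relators already form a normal subgroup, and no letter is killed since every number is a
  -- generator.
  have hrel : {x | ∃ r, IsRelator i r ∧ FreeGroup.mk r = x} = (φ.ker : Set (FreeGroup ℕ)) := by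
    ext x
    constructor
    · rintro ⟨r, hr | ⟨n, rfl, hn⟩, rfl⟩
      · rw [h2] at hr
        obtain ⟨w, hw, hφ⟩ := hr
        rwa [Encodable.encode_injective hw] at hφ
      · simp [h1] at hn
    · intro hx
      refine ⟨x.toWord, Or.inl ?_, FreeGroup.mk_toWord⟩
      rw [h2]
      exact ⟨_, rfl, by rwa [FreeGroup.mk_toWord]⟩
  rw [wordHom_eq_one_iff (isPresentationIndex_of_forall h1 h2), hrel,
    Subgroup.normalClosure_eq_self, MonoidHom.mem_ker]

/-- By the first isomorphism theorem the group is the range of `φ`, and left-orders restrict to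
subgroups. -/
theorem leftOrderable_groupOf_of_forall (h1 : ∀ n, phi i.unpair.1 n = Part.some 1)
    (h2 : ceSet i.unpair.2 = {n | ∃ w : Word, Encodable.encode w = n ∧ φ (FreeGroup.mk w) = 1})
    (hM : LeftOrderable M) : LeftOrderable (groupOf i) := by
  have hker : (wordHom i).ker = φ.ker := Subgroup.ext fun x =>
    wordHom_eq_one_iff_of_forall h1 h2 x
  let ι : groupOf i ≃* φ.range :=
    (QuotientGroup.quotientKerEquivOfSurjective _ (wordHom_surjective i)).symm.trans
      ((QuotientGroup.quotientMulEquivOfEq hker).trans (QuotientGroup.quotientKerEquivRange φ))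
  exact hM.of_injective (φ.range.subtype.comp ι.toMonoidHom)
    (Subtype.val_injective.comp ι.injective)

end AllGenerators

/-! ### Completeness -/

theorem mainTheorem12 :
    DetectionComplete IsPi02 leftOrderableIndices (fun i => BiOrderable (groupOf i)) := by
  constructor
  · obtain ⟨S, hS, h⟩ := exists_isPi02_biOrderable
    refine ⟨S, hS, Set.ext fun i => and_congr_right fun hi => (h i hi.1).symm⟩
  · rintro S ⟨R, hR, hS⟩
    obtain ⟨f, hf, rfl⟩ := ComputablePred.computable_iff.1 hR
    let T : ℕ → ℕ → Prop := fun e x => ∃ y, f (e, x, y) = true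
    obtain ⟨d, hd, hdT⟩ := exists_computable_ceSet (rePred_kleinHom_eq_one hf)
    let F : ℕ → ℕ := fun e => Nat.pair (Encodable.encode (Nat.Partrec.Code.const 1)) (d e)
    have h1 : ∀ e n, phi (F e).unpair.1 n = Part.some 1 := fun e n => by
      simp [F, phi, Nat.Partrec.Code.eval_const]
    have h2 : ∀ e, ceSet (F e).unpair.2 =
        {n | ∃ w : Word, Encodable.encode w = n ∧ kleinHom (T e) (FreeGroup.mk w) = 1} :=
      fun e => by simpa only [F, Nat.unpair_pair] using hdT e
    have hLO : ∀ e, LeftOrderable (groupOf (F e)) := fun e =>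
      leftOrderable_groupOf_of_forall (h1 e) (h2 e) leftOrderable_pi_kleinBottleGroup
    have hA : ∀ e, F e ∈ leftOrderableIndices := fun e =>
      ⟨isPresentationIndex_of_forall (h1 e) (h2 e), hLO e⟩
    have hker : ∀ e x, wordHom (F e) x = 1 ↔ kleinHom (T e) x = 1 := fun e =>
      wordHom_eq_one_iff_of_forall (h1 e) (h2 e)
    refine ⟨F, (Primrec₂.natPair.to_comp.comp (Computable.const _) hd), hA, fun e => ?_⟩
    rw [hS]
    constructor
    · intro hT
      refine ⟨hA e, (hLO e).biOrderable_of_commute fun g h => ?_⟩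
      obtain ⟨x, rfl⟩ := wordHom_surjective _ g
      obtain ⟨y, rfl⟩ := wordHom_surjective _ h
      -- Commutation is a statement about the kernel, so it transfers from `kleinHom (T e)`.
      rw [← mul_inv_eq_one, ← map_mul, ← map_mul, ← map_inv, ← map_mul, hker, map_mul, map_inv,
        map_mul, map_mul, mul_inv_eq_one]
      exact kleinHom_mul_comm hT x y
    · rintro ⟨-, hB⟩ x
      by_contra hx
      -- A bi-order would make the generator `b` of copy `x` trivial, as it is conjugate to its
      -- inverse by `a`.
      refine kleinHom_of_ne_one (T := T e) hx ((hker e _).1 (hB.eq_one_of_conj_eq_inv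
        (a := wordHom (F e) (FreeGroup.of (2 * x))) (eq_inv_of_mul_eq_one_left ?_)))
      rw [← map_inv, ← map_mul, ← map_mul, ← map_mul, hker]
      exact kleinHom_conj (T e) x
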